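/- Let $d\ge 1$, let $\mathcal{H}=\mathbb{C}^d$ with computational basis $\{|a\rangle\}_{a\in\mathbb{Z}_d}$, and write $|\vec a\rangle=|a_1\rangle\otimes\cdots\otimes|a_t\rangle$ for $\vec a\in\mathbb{Z}_d^t$. For $\vec a\in\mathbb{Z}_d^3$ let $wt(\vec a)\in\{1,2,3\}$ be the number of equal entries of $\vec a$ (the largest number of times that a value occurs in $\vec a$), let $O_+(\vec a)=1+(-d)^{wt(\vec a)-1}$, and define \[ O_+=\sum_{\vec a\in\mathbb{Z}_d^3}O_+(\vec a)\,|\vec a\rangle\langle\vec a|,\quad O_{123,124}=\sum_{\vec a\in\mathbb{Z}_d^4}O_+(a_1a_2a_3)\,O_+(a_1a_2a_4)\,|\vec a\rangle\langle\vec a|,\quad O_{123,145}=\sum_{\vec a\in\mathbb{Z}_d^5}O_+(a_1a_2a_3)\,O_+(a_1a_4a_5)\,|\vec a\rangle\langle\vec a|. \] Let $\mathcal{E}$ be a random unitary on $\mathcal{H}$ (a Borel probability measure on $U(d)$) that is a unitary $6$-design, i.e. $\mathbb{E}_{U\sim\mathcal{E}}\,U^{\otimes 6}X(U^\dagger)^{\otimes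 6}=\mathbb{E}_{U\sim\mathrm{Haar}}\,U^{\otimes 6}X(U^\dagger)^{\otimes 6}$ for every linear operator $X$ on $\mathcal{H}^{\otimes 6}$. Put $\Phi^t(X)=\mathbb{E}_{U\sim\mathcal{E}}\,(U^\dagger)^{\otimes t}XU^{\otimes t}$. Then for every pure state $\rho=|\psi\rangle\langle\psi|$ on $\mathcal{H}$ (with $\|\psi\|=1$), \[ \begin{aligned} \Gamma_6&:=\mathrm{Tr}[\Phi^6(O_+\otimes O_+)\rho^{\otimes 6}]=4\,\frac{d^4+59d^3+107d^2+109d+84}{d^4+14d^3+71d^2+154d+120}<10,\\ \Gamma_5&:=\mathrm{Tr}[\Phi^5(O_{123,145})\rho^{\otimes 5}]=\frac{48d^3+68d^2+60d+64}{d^3+9d^2+26d+24}<48,\\ \Gamma_4&:=\mathrm{Tr}[\Phi^4(O_{123,124})\rho^{\otimes 4}]=2\,\frac{7d^3+6d^2+3d+8}{d^2+5d+6}<14d,\\ \Gamma_3&:=\mathrm{Tr}[\Phi^3(O_+^2)\rho^{\otimes 3}]=\frac{6d^3-2d+8}{d+2}<6d^2. \end{aligned} \] -/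

import Mathlib

open MeasureTheory Matrix

noncomputable section

namespace UnitaryTwirl

/-! ### The unitary group `U(d)` as a compact topological group with its Haar probability measure -/

/-- The Borel `σ`-algebra on the unitary group `U(d)`. -/
instance instMeasurableSpaceUnitary (d : ℕ) : MeasurableSpace (unitaryGroup (Fin d) ℂ) :=
  borel _

instance instBorelSpaceUnitary (d : ℕ) : BorelSpace (unitaryGroup (Fin d) ℂ) := ⟨rfl⟩

instance instCompactSpaceUnitary (d : ℕ) : CompactSpace (unitaryGroup (Fin d) ℂ) := by
  refine (isCompact_iff_compactSpace
    (s := (unitaryGroup (Fin d) ℂ : Set (Matrix (Fin d) (Fin d) ℂ)))).mp ?_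
  have hK : IsCompact (Set.pi Set.univ fun _ : Fin d =>
      Set.pi Set.univ fun _ : Fin d => Metric.closedBall (0 : ℂ) 1) :=
    isCompact_univ_pi fun _ => isCompact_univ_pi fun _ => isCompact_closedBall _ _
  refine hK.of_isClosed_subset (isClosed_unitary (R := Matrix (Fin d) (Fin d) ℂ)) ?_
  intro U hU i _ j _
  simpa using entry_norm_bound_of_unitary hU i j

/-- The Haar probability measure on `U(d)`: the left-invariant measure of total mass `1`. -/
def haarUnitary (d : ℕ) : Measure (unitaryGroup (Fin d) ℂ) := Measure.haarMeasure ⊤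

/-! ### Operators on `t` copies of `ℂ^d`

The computational basis of `(ℂ^d)^{⊗ t}` is indexed by the strings `a : Fin t → Fin d`. -/

/-- The operators on `(ℂ^d)^{⊗ t}`, written in the computational basis. -/
abbrev Op (d t : ℕ) : Type := Matrix (Fin t → Fin d) (Fin t → Fin d) ℂ

/-- The tensor power `A^{⊗ t}`. -/
def tensorPower {d : ℕ} (A : Matrix (Fin d) (Fin d) ℂ) (t : ℕ) : Op d t :=
  Matrix.of fun a b => ∏ i, A (a i) (b i)

/-- The tensor product `A ⊗ B` of an operator on the first `s` copies with an operator on the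
last `t` copies. -/
def tensorProduct {d s t : ℕ} (A : Op d s) (B : Op d t) : Op d (s + t) :=
  Matrix.of fun a b =>
    A (fun i => a (Fin.castAdd t i)) (fun i => b (Fin.castAdd t i)) *
      B (fun i => a (Fin.natAdd s i)) (fun i => b (Fin.natAdd s i))

/-- The twirling `X ↦ 𝔼_U U^{⊗ t} X (U†)^{⊗ t}`, where `U` has law `μ` (entrywise integral; the
integrand is a bounded continuous function of `U`). -/
def twirl {d t : ℕ} (μ : Measure (unitaryGroup (Fin d) ℂ)) (X : Op d t) : Op d t :=
  Matrix.of fun a b =>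
    ∫ U, (tensorPower (U : Matrix (Fin d) (Fin d) ℂ) t * X *
      tensorPower ((U : Matrix (Fin d) (Fin d) ℂ)ᴴ) t) a b ∂μ

/-- The twirling `Φ^t(X) = 𝔼_U (U†)^{⊗ t} X U^{⊗ t}` of observables, where `U` has law `μ`. -/
def twirlObs {d t : ℕ} (μ : Measure (unitaryGroup (Fin d) ℂ)) (X : Op d t) : Op d t :=
  Matrix.of fun a b =>
    ∫ U, (tensorPower ((U : Matrix (Fin d) (Fin d) ℂ)ᴴ) t * X *
      tensorPower (U : Matrix (Fin d) (Fin d) ℂ) t) a b ∂μ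

/-- A random unitary with law `μ` is a unitary `k`-design if its `k`-fold twirling is the `k`-fold
twirling of the Haar measure. -/
def IsUnitaryDesign {d : ℕ} (k : ℕ) (μ : Measure (unitaryGroup (Fin d) ℂ)) : Prop :=
  IsProbabilityMeasure μ ∧ ∀ X : Op d k, twirl μ X = twirl (haarUnitary d) X

/-- `ρ` is a pure state: `ρ = |ψ⟩⟨ψ|` for a unit vector `ψ`. -/
def IsPureState {d : ℕ} (ρ : Matrix (Fin d) (Fin d) ℂ) : Prop :=
  ∃ ψ : Fin d → ℂ, star ψ ⬝ᵥ ψ = 1 ∧ ρ = vecMulVec ψ (star ψ)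

/-! ### The observables -/

/-- `wt(a)`: the number of equal entries of the string `a`, that is, the largest number of times
that a value occurs in `a`. -/
def wt {d t : ℕ} (a : Fin t → Fin d) : ℕ :=
  Finset.univ.sup fun i => (Finset.univ.filter fun j => a j = a i).card

/-- The coefficient `O₊(a₁a₂a₃) = 1 + (-d)^{wt(a) - 1}`; here `wt(a)` is `1`, `2` or `3`. -/
def oPlusCoeff {d : ℕ} (a : Fin 3 → Fin d) : ℂ := 1 + (-(d : ℂ)) ^ (wt a - 1)

/-- `O₊ = ∑_a [1 + (-d)^{wt(a) - 1}] |a⟩⟨a|`, an observable on three copies. -/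
def oPlus (d : ℕ) : Op d 3 := Matrix.diagonal oPlusCoeff

/-- `O_{123,124} = ∑_a O₊(a₁a₂a₃) O₊(a₁a₂a₄) |a⟩⟨a|`. -/
def o123124 (d : ℕ) : Op d 4 :=
  Matrix.diagonal fun a => oPlusCoeff ![a 0, a 1, a 2] * oPlusCoeff ![a 0, a 1, a 3]

/-- `O_{123,145} = ∑_a O₊(a₁a₂a₃) O₊(a₁a₄a₅) |a⟩⟨a|`. -/
def o123145 (d : ℕ) : Op d 5 :=
  Matrix.diagonal fun a => oPlusCoeff ![a 0, a 1, a 2] * oPlusCoeff ![a 0, a 3, a 4]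

/-! ### The variance terms -/

/-- `Tr[Φ^t(Q) ρ^{⊗ t}]`, with the twirling over the random unitary of law `μ`. -/
def varianceTerm {d t : ℕ} (μ : Measure (unitaryGroup (Fin d) ℂ)) (Q : Op d t)
    (ρ : Matrix (Fin d) (Fin d) ℂ) : ℂ :=
  (twirlObs μ Q * tensorPower ρ t).trace

/-- `Γ₃ = Tr[Φ³(O₊²) ρ^{⊗ 3}]`. -/
def Gamma3 {d : ℕ} (μ : Measure (unitaryGroup (Fin d) ℂ)) (ρ : Matrix (Fin d) (Fin d) ℂ) : ℂ :=
  varianceTerm μ (oPlus d ^ 2) ρ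

/-- `Γ₄ = Tr[Φ⁴(O_{123,124}) ρ^{⊗ 4}]`. -/
def Gamma4 {d : ℕ} (μ : Measure (unitaryGroup (Fin d) ℂ)) (ρ : Matrix (Fin d) (Fin d) ℂ) : ℂ :=
  varianceTerm μ (o123124 d) ρ

/-- `Γ₅ = Tr[Φ⁵(O_{123,145}) ρ^{⊗ 5}]`. -/
def Gamma5 {d : ℕ} (μ : Measure (unitaryGroup (Fin d) ℂ)) (ρ : Matrix (Fin d) (Fin d) ℂ) : ℂ :=
  varianceTerm μ (o123145 d) ρ

/-- `Γ₆ = Tr[Φ⁶(O₊ ⊗ O₊) ρ^{⊗ 6}]`. -/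
def Gamma6 {d : ℕ} (μ : Measure (unitaryGroup (Fin d) ℂ)) (ρ : Matrix (Fin d) (Fin d) ℂ) : ℂ :=
  varianceTerm μ (tensorProduct (oPlus d) (oPlus d)) ρ

end UnitaryTwirl

end

namespace UnitaryTwirl

/-- The amplitude `⟨v|U|ψ⟩`. -/
def amp {d : ℕ} (ψ : Fin d → ℂ) (U : unitaryGroup (Fin d) ℂ) (v : Fin d) : ℂ :=
  ((U : Matrix (Fin d) (Fin d) ℂ) *ᵥ ψ) v

/-- The outcome probability `|⟨v|U|ψ⟩|²`, as a complex number. -/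
def prob {d : ℕ} (ψ : Fin d → ℂ) (U : unitaryGroup (Fin d) ℂ) (v : Fin d) : ℂ :=
  amp ψ U v * star (amp ψ U v)

variable {d : ℕ} {ψ : Fin d → ℂ}

@[fun_prop]
lemma continuous_amp (v : Fin d) : Continuous fun U => amp ψ U v :=
  (continuous_apply v).comp (continuous_subtype_val.matrix_mulVec continuous_const)

@[fun_prop]
lemma continuous_prob (v : Fin d) : Continuous fun U => prob ψ U v :=
  (continuous_amp v).mul (continuous_amp v).star

lemma integrable_of_continuous {μ : Measure (unitaryGroup (Fin d) ℂ)} [IsFiniteMeasure μ]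
    {f : unitaryGroup (Fin d) ℂ → ℂ} (hf : Continuous f) : Integrable f μ :=
  hf.integrable_of_hasCompactSupport (HasCompactSupport.of_compactSpace f)

instance : IsProbabilityMeasure (haarUnitary d) :=
  ⟨Measure.haarMeasure_self (K₀ := (⊤ : TopologicalSpace.PositiveCompacts _))⟩

instance : (haarUnitary d).IsMulLeftInvariant := by
  unfold haarUnitary; infer_instance

lemma sum_prob (hψ : star ψ ⬝ᵥ ψ = 1) (U : unitaryGroup (Fin d) ℂ) : ∑ v, prob ψ U v = 1 := by
  have h : star ((U : Matrix (Fin d) (Fin d) ℂ) *ᵥ ψ) ⬝ᵥ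
      ((U : Matrix (Fin d) (Fin d) ℂ) *ᵥ ψ) = 1 := by
    rw [star_mulVec, dotProduct_mulVec, vecMul_vecMul, ← star_eq_conjTranspose,
      UnitaryGroup.star_mul_self, vecMul_one, hψ]
  rw [← h]
  simp [dotProduct, prob, amp, mul_comm]

/-- The complex reflection `1 + (ω - 1)|u⟩⟨u|`. -/
def reflection (u : Fin d → ℂ) (ω : ℂ) (hu : star u ⬝ᵥ u = 1) (hω : ω * star ω = 1) :
    unitaryGroup (Fin d) ℂ :=
  ⟨1 + (ω - 1) • vecMulVec u (star u), by
    rw [mem_unitaryGroup_iff]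
    have h1 : star (vecMulVec u (star u)) = vecMulVec u (star u) := by
      rw [star_eq_conjTranspose, conjTranspose_vecMulVec, star_star]
    have h2 : vecMulVec u (star u) * vecMulVec u (star u) = vecMulVec u (star u) := by
      rw [vecMulVec_mul_vecMulVec, hu]; simp
    rw [star_add, star_smul, h1, star_one, mul_add, add_mul, add_mul, smul_mul_smul_comm, h2]
    simp only [mul_one, one_mul]
    rw [add_assoc, ← add_smul, ← add_smul, star_sub, star_one]
    have : (ω - 1) + ((star ω - 1) + (ω - 1) * (star ω - 1)) = 0 := by linear_combination hω
    rw [this, zero_smul, add_zero]⟩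

lemma amp_reflection_mul (u : Fin d → ℂ) (ω : ℂ) (hu : star u ⬝ᵥ u = 1) (hω : ω * star ω = 1)
    (U : unitaryGroup (Fin d) ℂ) (v : Fin d) :
    amp ψ (reflection u ω hu hω * U) v =
      amp ψ U v + (ω - 1) * (u v * ∑ w, star (u w) * amp ψ U w) := by
  simp only [amp, reflection, UnitaryGroup.mul_val]
  rw [← mulVec_mulVec, add_mulVec, one_mulVec, smul_mulVec, vecMulVec_mulVec]
  simp [dotProduct, mul_comm]

lemma exists_phase (w : Fin d) (ω : ℂ) (hω : ω * star ω = 1) :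
    ∃ V : unitaryGroup (Fin d) ℂ, ∀ (ψ : Fin d → ℂ) (U : unitaryGroup (Fin d) ℂ),
      amp ψ (V * U) w = ω * amp ψ U w ∧ ∀ v ≠ w, amp ψ (V * U) v = amp ψ U v := by
  have hu : star (Pi.single w (1 : ℂ)) ⬝ᵥ (Pi.single w (1 : ℂ)) = 1 := by simp
  have hs : ∀ f : Fin d → ℂ, ∑ x, star (Pi.single (M := fun _ => ℂ) w (1 : ℂ) x) * f x = f w := by
    intro f
    rw [Finset.sum_eq_single w] <;> simp +contextual
  refine ⟨reflection _ ω hu hω, fun ψ U => ⟨?_, fun v hv => ?_⟩⟩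
  · rw [amp_reflection_mul, hs, Pi.single_eq_same]; ring
  · rw [amp_reflection_mul, Pi.single_eq_of_ne hv]; ring

lemma exists_rotation {v w : Fin d} (hvw : v ≠ w) (θ : ℝ) :
    ∃ V : unitaryGroup (Fin d) ℂ, ∀ (ψ : Fin d → ℂ) (U : unitaryGroup (Fin d) ℂ),
      amp ψ (V * U) v = Real.cos θ * amp ψ U v + Real.sin θ * amp ψ U w := by
  set u : Fin d → ℂ := Pi.single v (Real.sin (θ / 2) : ℂ) - Pi.single w (Real.cos (θ / 2) : ℂ)
    with hudef
  have huv : u v = Real.sin (θ / 2) := by simp [hudef, hvw]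
  have huw : u w = -Real.cos (θ / 2) := by simp [hudef, hvw]
  have hs : ∀ f : Fin d → ℂ,
      ∑ x, star (u x) * f x = Real.sin (θ / 2) * f v - Real.cos (θ / 2) * f w := by
    intro f
    rw [Fintype.sum_eq_add v w hvw, huv, huw]
    · simp only [star_neg, Complex.star_def, Complex.conj_ofReal]
      ring
    · rintro x ⟨h1, h2⟩
      simp [hudef, h1, h2]
  have hsc : (Real.sin (θ / 2) : ℂ) ^ 2 + (Real.cos (θ / 2) : ℂ) ^ 2 = 1 := by
    exact_mod_cast Real.sin_sq_add_cos_sq (θ / 2)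
  have hu : star u ⬝ᵥ u = 1 := by
    have := hs u
    rw [huv, huw] at this
    simp only [dotProduct, Pi.star_apply]
    rw [this]; linear_combination hsc
  refine ⟨reflection u (-1) hu (by simp), fun ψ U => ?_⟩
  rw [amp_reflection_mul, hs, huv]
  have h1 : (Real.cos θ : ℂ) = 1 - 2 * (Real.sin (θ / 2) : ℂ) ^ 2 := by
    have : Real.cos θ = 1 - 2 * Real.sin (θ / 2) ^ 2 := by
      rw [← Real.cos_two_mul_eq_one_sub]; ring_nf
    exact_mod_cast this
  have h2 : (Real.sin θ : ℂ) = 2 * Real.sin (θ / 2) * Real.cos (θ / 2) := by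
    have : Real.sin θ = 2 * Real.sin (θ / 2) * Real.cos (θ / 2) := by
      rw [← Real.sin_two_mul]; ring_nf
    exact_mod_cast this
  rw [h1, h2]; ring

lemma integral_phase_eq_zero {v w : Fin d} (hvw : v ≠ w) (i j k l : ℕ) (hkl : k ≠ l) :
    ∫ U, amp ψ U v ^ i * amp ψ U w ^ k * (star (amp ψ U v) ^ j * star (amp ψ U w) ^ l)
      ∂haarUnitary d = 0 := by
  have hne : ((k : ℂ) - l) ≠ 0 := sub_ne_zero.mpr (by exact_mod_cast hkl)
  set α : ℝ := Real.pi / ((k : ℝ) - l) with hα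
  set ω : ℂ := Complex.exp (α * Complex.I) with hω
  have hst : star ω = Complex.exp (-(α * Complex.I)) := by
    rw [hω, Complex.star_def, ← Complex.exp_conj]; simp
  have hω1 : ω * star ω = 1 := by rw [hst, hω, ← Complex.exp_add]; simp
  have hω2 : ω ^ k * star ω ^ l = -1 := by
    rw [hst, hω, ← Complex.exp_nat_mul, ← Complex.exp_nat_mul, ← Complex.exp_add,
      ← Complex.exp_pi_mul_I]
    congr 1
    rw [hα]; push_cast; field_simp; ring
  obtain ⟨V, hV⟩ := exists_phase w ω hω1
  set I := ∫ U, amp ψ U v ^ i * amp ψ U w ^ k * (star (amp ψ U v) ^ j * star (amp ψ U w) ^ l)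
      ∂haarUnitary d with hI
  have h : I = (ω ^ k * star ω ^ l) * I := by
    conv_lhs => rw [hI, ← integral_mul_left_eq_self _ V]
    rw [hI, ← integral_const_mul]
    congr 1; ext U
    rw [(hV ψ U).1, (hV ψ U).2 v hvw, star_mul', mul_pow, mul_pow]; ring
  rw [hω2] at h
  linear_combination h / 2

/-- The moments of a single outcome probability under the Haar measure. -/
noncomputable def haarMoment (ψ : Fin d → ℂ) (n : ℕ) (v : Fin d) : ℂ := ∫ U, prob ψ U v ^ n ∂haarUnitary d

lemma integral_norm_pow_add (v w : Fin d) (hvw : v ≠ w) (n : ℕ) (t : ℝ) :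
    ∫ U, ((amp ψ U v + t * amp ψ U w) * star (amp ψ U v + t * amp ψ U w)) ^ n ∂haarUnitary d =
      (1 + t ^ 2 : ℂ) ^ n * haarMoment ψ n v := by
  obtain ⟨V, hV⟩ := exists_rotation hvw (Real.arctan t)
  rw [haarMoment, ← integral_mul_left_eq_self (fun U => prob ψ U v ^ n) V, ← integral_const_mul]
  congr 1; ext U
  have hc := (Real.cos_arctan_pos t).ne'
  have h1 : Real.sin (Real.arctan t) = Real.cos (Real.arctan t) * t := by
    conv_rhs => rw [← Real.tan_arctan t, Real.arctan_tan (Real.neg_pi_div_two_lt_arctan _)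
      (Real.arctan_lt_pi_div_two _), Real.tan_eq_sin_div_cos]
    field_simp
  have h2 : (1 + t ^ 2) * Real.cos (Real.arctan t) ^ 2 = 1 := by
    rw [Real.cos_sq_arctan]; field_simp
  have h2' : (1 + t ^ 2 : ℂ) * (Real.cos (Real.arctan t) : ℂ) ^ 2 = 1 := by exact_mod_cast h2
  rw [prob, hV ψ U, h1, ← mul_pow]
  congr 1
  simp only [star_add, star_mul', Complex.star_def, Complex.conj_ofReal, Complex.ofReal_mul]
  linear_combination -((amp ψ U v + t * amp ψ U w) * ((starRingEnd ℂ) (amp ψ U v) +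
    t * (starRingEnd ℂ) (amp ψ U w))) * h2'

lemma integral_norm_pow_add_expand (v w : Fin d) (hvw : v ≠ w) (n : ℕ) (t : ℝ) :
    ∫ U, ((amp ψ U v + t * amp ψ U w) * star (amp ψ U v + t * amp ψ U w)) ^ n ∂haarUnitary d =
      ∑ k ∈ Finset.range (n + 1), (n.choose k : ℂ) ^ 2 *
        (∫ U, prob ψ U v ^ (n - k) * prob ψ U w ^ k ∂haarUnitary d) * ((t : ℂ) ^ 2) ^ k := by
  have hexp : ∀ U : unitaryGroup (Fin d) ℂ,
      ((amp ψ U v + t * amp ψ U w) * star (amp ψ U v + t * amp ψ U w)) ^ n =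
      ∑ k ∈ Finset.range (n + 1), ∑ l ∈ Finset.range (n + 1),
        ((n.choose k : ℂ) * n.choose l * t ^ k * t ^ l) *
        (amp ψ U v ^ (n - k) * amp ψ U w ^ k *
          (star (amp ψ U v) ^ (n - l) * star (amp ψ U w) ^ l)) := by
    intro U
    rw [mul_pow, star_add, star_mul', add_comm (amp ψ U v), add_comm (star (amp ψ U v)),
      add_pow, add_pow, Finset.sum_mul_sum]
    refine Finset.sum_congr rfl fun k _ => Finset.sum_congr rfl fun l _ => ?_
    have : star (t : ℂ) = t := Complex.conj_ofReal t
    rw [this]; ring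
  simp_rw [hexp]
  rw [integral_finsetSum _ fun k _ => integrable_of_continuous (by fun_prop)]
  refine Finset.sum_congr rfl fun k hk => ?_
  rw [integral_finsetSum _ fun k _ => integrable_of_continuous (by fun_prop),
    Finset.sum_eq_single k]
  · rw [integral_const_mul, ← pow_mul]
    simp only [prob, mul_pow]
    have : ∀ U : unitaryGroup (Fin d) ℂ, amp ψ U v ^ (n - k) * amp ψ U w ^ k *
        (star (amp ψ U v) ^ (n - k) * star (amp ψ U w) ^ k) =
        amp ψ U v ^ (n - k) * star (amp ψ U v) ^ (n - k) *
          (amp ψ U w ^ k * star (amp ψ U w) ^ k) := fun U => by ring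
    simp_rw [this]; ring
  · intro l _ hl
    rw [integral_const_mul, integral_phase_eq_zero hvw _ _ _ _ (Ne.symm hl), mul_zero]
  · intro h; exact absurd hk h

lemma choose_mul_integral (v w : Fin d) (hvw : v ≠ w) (j k : ℕ) :
    ((j + k).choose k : ℂ) * ∫ U, prob ψ U v ^ j * prob ψ U w ^ k ∂haarUnitary d =
      haarMoment ψ (j + k) v := by
  set n := j + k with hn
  set M : ℕ → ℂ := fun k => ∫ U, prob ψ U v ^ (n - k) * prob ψ U w ^ k ∂haarUnitary d with hM
  set P : Polynomial ℂ := ∑ k ∈ Finset.range (n + 1),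
    Polynomial.C ((n.choose k : ℂ) ^ 2 * M k - n.choose k * haarMoment ψ n v) * Polynomial.X ^ k
    with hP
  have hroot : ∀ t : ℝ, P.IsRoot ((t : ℂ) ^ 2) := by
    intro t
    have h := (integral_norm_pow_add_expand (ψ := ψ) v w hvw n t).symm.trans
      (integral_norm_pow_add v w hvw n t)
    rw [add_comm (1 : ℂ), add_pow, Finset.sum_mul, ← sub_eq_zero, ← Finset.sum_sub_distrib] at h
    rw [Polynomial.IsRoot, hP, Polynomial.eval_finsetSum, ← h]
    refine Finset.sum_congr rfl fun k _ => ?_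
    simp only [Polynomial.eval_mul, Polynomial.eval_C, Polynomial.eval_pow, Polynomial.eval_X,
      one_pow, hM]
    ring
  have hP0 : P = 0 := by
    refine Polynomial.eq_zero_of_infinite_isRoot P
      ((Set.infinite_range_of_injective (f := fun m : ℕ => ((m : ℝ) : ℂ) ^ 2) ?_).mono ?_)
    · intro a b hab
      have : (a : ℂ) ^ 2 = (b : ℂ) ^ 2 := by simpa using hab
      have : a ^ 2 = b ^ 2 := by exact_mod_cast this
      exact Nat.pow_left_injective two_ne_zero this
    · rintro _ ⟨m, rfl⟩; exact hroot m
  have hc : P.coeff k = (n.choose k : ℂ) ^ 2 * M k - n.choose k * haarMoment ψ n v := by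
    rw [hP, Polynomial.finsetSum_coeff, Finset.sum_eq_single k]
    · rw [Polynomial.coeff_C_mul, Polynomial.coeff_X_pow_self, mul_one]
    · intro b _ hb; rw [Polynomial.coeff_C_mul, Polynomial.coeff_X_pow, if_neg hb.symm, mul_zero]
    · intro h; simp at h; omega
  rw [hP0, Polynomial.coeff_zero] at hc
  have hne : (n.choose k : ℂ) ≠ 0 := by exact_mod_cast (Nat.choose_pos (by omega)).ne'
  have hMk : M k = ∫ U, prob ψ U v ^ j * prob ψ U w ^ k ∂haarUnitary d := by
    rw [hM, hn]; simp
  rw [← hMk]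
  apply mul_left_cancel₀ hne
  linear_combination -hc

lemma haarMoment_zero (v : Fin d) : haarMoment ψ 0 v = 1 := by simp [haarMoment]

lemma haarMoment_succ (hψ : star ψ ⬝ᵥ ψ = 1) (n : ℕ) (v : Fin d) :
    haarMoment ψ (n + 1) v * (n + d) = (n + 1) * haarMoment ψ n v := by
  have h : haarMoment ψ n v = ∑ w, ∫ U, prob ψ U v ^ n * prob ψ U w ∂haarUnitary d := by
    rw [← integral_finsetSum _ fun w _ => integrable_of_continuous (by fun_prop), haarMoment]
    simp_rw [← Finset.mul_sum, sum_prob hψ, mul_one]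
  have hw : ∀ w ∈ Finset.univ.erase v, (n + 1 : ℂ) *
      ∫ U, prob ψ U v ^ n * prob ψ U w ∂haarUnitary d = haarMoment ψ (n + 1) v := by
    intro w hw
    have := choose_mul_integral (ψ := ψ) v w (Finset.ne_of_mem_erase hw).symm n 1
    simpa using this
  rw [h, Finset.mul_sum, ← Finset.add_sum_erase _ _ (Finset.mem_univ v), Finset.sum_congr rfl hw,
    Finset.sum_const, Finset.card_erase_of_mem (Finset.mem_univ v), Finset.card_univ,
    Fintype.card_fin, nsmul_eq_mul, Nat.cast_pred (Fin.pos v)]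
  simp_rw [← pow_succ]
  rw [← haarMoment]; ring

lemma tensorPower_mul (A B : Matrix (Fin d) (Fin d) ℂ) (t : ℕ) :
    tensorPower (A * B) t = tensorPower A t * tensorPower B t := by
  ext a b
  simp only [tensorPower, mul_apply, of_apply, Finset.prod_univ_sum, Fintype.piFinset_univ,
    Finset.prod_mul_distrib]

lemma conj_pure_apply_self (U : unitaryGroup (Fin d) ℂ) (v : Fin d) :
    ((U : Matrix (Fin d) (Fin d) ℂ) * vecMulVec ψ (star ψ) *
      (U : Matrix (Fin d) (Fin d) ℂ)ᴴ) v v = prob ψ U v := by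
  rw [mul_vecMulVec, vecMulVec_mul, ← star_mulVec, vecMulVec_apply]
  rfl

lemma twirl_pure_apply_self (μ : Measure (unitaryGroup (Fin d) ℂ)) {t : ℕ} (a : Fin t → Fin d) :
    twirl μ (tensorPower (vecMulVec ψ (star ψ)) t) a a = ∫ U, ∏ i, prob ψ U (a i) ∂μ := by
  simp only [twirl, of_apply, ← tensorPower_mul]
  simp only [tensorPower, of_apply, conj_pure_apply_self]

lemma continuous_tensorPower {X : Type*} [TopologicalSpace X]
    {A : X → Matrix (Fin d) (Fin d) ℂ} (hA : Continuous A) (t : ℕ) :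
    Continuous fun x => tensorPower (A x) t := by
  refine continuous_matrix fun a b => ?_
  simp only [tensorPower, of_apply]
  exact continuous_finsetProd _ fun i _ => hA.matrix_elem (a i) (b i)

lemma integral_trace_mul {n : Type*} [Fintype n] (μ : Measure (unitaryGroup (Fin d) ℂ))
    [IsFiniteMeasure μ] {F : unitaryGroup (Fin d) ℂ → Matrix n n ℂ} (hF : Continuous F)
    (B : Matrix n n ℂ) :
    ∫ U, (F U * B).trace ∂μ = (Matrix.of (fun a b => ∫ U, F U a b ∂μ) * B).trace := by
  have hF' : ∀ a b, Continuous fun U => F U a b := fun a b => hF.matrix_elem a b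
  simp only [trace, diag_apply, mul_apply, of_apply]
  rw [integral_finsetSum _ fun a _ => integrable_of_continuous (by fun_prop)]
  refine Finset.sum_congr rfl fun a _ => ?_
  rw [integral_finsetSum _ fun b _ => integrable_of_continuous (by fun_prop)]
  exact Finset.sum_congr rfl fun b _ => integral_mul_const _ _

lemma varianceTerm_diagonal (μ : Measure (unitaryGroup (Fin d) ℂ)) [IsFiniteMeasure μ] {t : ℕ}
    (q : (Fin t → Fin d) → ℂ) :
    varianceTerm μ (diagonal q) (vecMulVec ψ (star ψ)) =
      ∫ U, ∑ a, q a * ∏ i, prob ψ U (a i) ∂μ := by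
  have hU : ∀ U : unitaryGroup (Fin d) ℂ, ∑ a, q a * ∏ i, prob ψ U (a i) =
      (tensorPower ((U : Matrix (Fin d) (Fin d) ℂ)ᴴ) t * diagonal q *
        tensorPower (U : Matrix (Fin d) (Fin d) ℂ) t *
          tensorPower (vecMulVec ψ (star ψ)) t).trace := by
    intro U
    trans (diagonal q * (tensorPower (U : Matrix (Fin d) (Fin d) ℂ) t *
      tensorPower (vecMulVec ψ (star ψ)) t *
      tensorPower ((U : Matrix (Fin d) (Fin d) ℂ)ᴴ) t)).trace
    · simp only [← tensorPower_mul, trace, diag_apply, diagonal_mul]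
      simp only [tensorPower, of_apply, conj_pure_apply_self]
    · rw [← mul_assoc, trace_mul_comm, ← mul_assoc, ← mul_assoc]
  simp_rw [hU]
  rw [integral_trace_mul]
  · rfl
  · exact ((continuous_tensorPower continuous_subtype_val.matrix_conjTranspose t).matrix_mul
      continuous_const).matrix_mul (continuous_tensorPower continuous_subtype_val t)

lemma integral_prod_prob_snoc (hψ : star ψ ⬝ᵥ ψ = 1) (μ : Measure (unitaryGroup (Fin d) ℂ))
    [IsFiniteMeasure μ] {t : ℕ} (a : Fin t → Fin d) :
    ∫ U, ∏ i, prob ψ U (a i) ∂μ =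
      ∑ b, ∫ U, ∏ i, prob ψ U (Fin.snoc (α := fun _ => Fin d) a b i) ∂μ := by
  rw [← integral_finsetSum _ fun b _ => integrable_of_continuous (by fun_prop)]
  simp only [Fin.prod_univ_castSucc, Fin.snoc_castSucc, Fin.snoc_last, ← Finset.mul_sum,
    sum_prob hψ, mul_one]

lemma IsUnitaryDesign.integral_prod_prob {k : ℕ} {μ : Measure (unitaryGroup (Fin d) ℂ)}
    (hμ : IsUnitaryDesign k μ) (hψ : star ψ ⬝ᵥ ψ = 1) {t : ℕ} (ht : t ≤ k) (a : Fin t → Fin d) :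
    ∫ U, ∏ i, prob ψ U (a i) ∂μ = ∫ U, ∏ i, prob ψ U (a i) ∂haarUnitary d := by
  have := hμ.1
  induction ht using Nat.decreasingInduction with
  | self => rw [← twirl_pure_apply_self, ← twirl_pure_apply_self, hμ.2]
  | of_succ t _ ih =>
    rw [integral_prod_prob_snoc hψ, integral_prod_prob_snoc hψ]
    exact Finset.sum_congr rfl fun b _ => ih _

lemma IsUnitaryDesign.integral_pow_mul_pow {n : ℕ} {μ : Measure (unitaryGroup (Fin d) ℂ)}
    (hμ : IsUnitaryDesign n μ) (hψ : star ψ ⬝ᵥ ψ = 1) {j k : ℕ} (hjk : j + k ≤ n) (v w : Fin d) :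
    ∫ U, prob ψ U v ^ j * prob ψ U w ^ k ∂μ =
      ∫ U, prob ψ U v ^ j * prob ψ U w ^ k ∂haarUnitary d := by
  simpa [Fin.prod_univ_add] using
    hμ.integral_prod_prob hψ hjk (Fin.append (fun _ => v) (fun _ => w))

lemma haarMoment_eq (hψ : star ψ ⬝ᵥ ψ = 1) (n : ℕ) (v : Fin d) :
    haarMoment ψ n v = n.factorial / ∏ i ∈ Finset.range n, ((d : ℂ) + i) := by
  have hne : ∀ i : ℕ, (d : ℂ) + i ≠ 0 := fun i => by
    have := Fin.pos v
    exact_mod_cast (by omega : d + i ≠ 0)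
  induction n with
  | zero => simp [haarMoment_zero]
  | succ n ih =>
    have h := haarMoment_succ hψ n v
    rw [ih, add_comm (n : ℂ) d] at h
    have h2 : ∏ i ∈ Finset.range n, ((d : ℂ) + i) ≠ 0 :=
      Finset.prod_ne_zero_iff.mpr fun i _ => hne i
    rw [Finset.prod_range_succ, eq_div_iff (mul_ne_zero h2 (hne n)), Nat.factorial_succ]
    push_cast
    field_simp at h
    linear_combination h

/-- The power sum `∑ᵥ |⟨v|U|ψ⟩|^(2j)`. -/
def powerSum (ψ : Fin d → ℂ) (j : ℕ) (U : unitaryGroup (Fin d) ℂ) : ℂ := ∑ v, prob ψ U v ^ j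

@[fun_prop]
lemma continuous_powerSum (j : ℕ) : Continuous (powerSum ψ j) := by
  unfold powerSum; fun_prop

lemma IsUnitaryDesign.integral_powerSum {n : ℕ} {μ : Measure (unitaryGroup (Fin d) ℂ)}
    (hμ : IsUnitaryDesign n μ) (hψ : star ψ ⬝ᵥ ψ = 1) {j : ℕ} (hj : j ≤ n) :
    ∫ U, powerSum ψ j U ∂μ = d * (j.factorial / ∏ i ∈ Finset.range j, ((d : ℂ) + i)) := by
  have := hμ.1
  simp only [powerSum]
  rw [integral_finsetSum _ fun v _ => integrable_of_continuous (by fun_prop)]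
  have : ∀ v ∈ Finset.univ, ∫ U, prob ψ U v ^ j ∂μ =
      j.factorial / ∏ i ∈ Finset.range j, ((d : ℂ) + i) := fun v _ => by
    rw [← haarMoment_eq hψ j v, haarMoment]
    simpa using hμ.integral_pow_mul_pow hψ (j := j) (k := 0) hj v v
  rw [Finset.sum_congr rfl this]
  simp

lemma IsUnitaryDesign.integral_powerSum_mul {n : ℕ} {μ : Measure (unitaryGroup (Fin d) ℂ)}
    (hμ : IsUnitaryDesign n μ) (hψ : star ψ ⬝ᵥ ψ = 1) {j k : ℕ} (hjk : j + k ≤ n) :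
    ∫ U, powerSum ψ j U * powerSum ψ k U ∂μ =
      d * (1 + (d - 1) / (j + k).choose k) *
        ((j + k).factorial / ∏ i ∈ Finset.range (j + k), ((d : ℂ) + i)) := by
  have := hμ.1
  simp only [powerSum, Finset.sum_mul_sum]
  rw [integral_finsetSum _ fun v _ => integrable_of_continuous (by fun_prop)]
  have key : ∀ v ∈ Finset.univ, ∫ U, ∑ w, prob ψ U v ^ j * prob ψ U w ^ k ∂μ =
      (1 + (d - 1) / (j + k).choose k) *
        ((j + k).factorial / ∏ i ∈ Finset.range (j + k), ((d : ℂ) + i)) := fun v _ => by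
    have hch : ((j + k).choose k : ℂ) ≠ 0 := by exact_mod_cast (Nat.choose_pos (by omega)).ne'
    rw [integral_finsetSum _ fun w _ => integrable_of_continuous (by fun_prop),
      ← Finset.add_sum_erase _ _ (Finset.mem_univ v), ← haarMoment_eq hψ _ v]
    have hw : ∀ w ∈ Finset.univ.erase v, ∫ U, prob ψ U v ^ j * prob ψ U w ^ k ∂μ =
        haarMoment ψ (j + k) v / (j + k).choose k := fun w hw => by
      rw [hμ.integral_pow_mul_pow hψ hjk, eq_div_iff hch, mul_comm,
        choose_mul_integral v w (Finset.ne_of_mem_erase hw).symm]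
    rw [Finset.sum_congr rfl hw, hμ.integral_pow_mul_pow hψ hjk, Finset.sum_const,
      Finset.card_erase_of_mem (Finset.mem_univ v), Finset.card_univ, Fintype.card_fin,
      nsmul_eq_mul, Nat.cast_pred (Fin.pos v)]
    simp only [← pow_add]
    rw [← haarMoment]
    ring
  rw [Finset.sum_congr rfl key]
  simp [mul_assoc]

lemma sum_fin_succ_fun {α M : Type*} [Fintype α] [AddCommMonoid M] {n : ℕ}
    (f : (Fin (n + 1) → α) → M) :
    ∑ a, f a = ∑ x, ∑ a : Fin n → α, f (vecCons x a) := by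
  rw [← (Fin.consEquiv fun _ => α).sum_comp, Fintype.sum_prod_type]
  rfl

lemma sum_fin_zero_fun {α M : Type*} [Fintype α] [AddCommMonoid M] (f : (Fin 0 → α) → M) :
    ∑ a, f a = f ![] := Fintype.sum_subsingleton _ _

lemma wt_cons₃ (x y z : Fin d) :
    wt ![x, y, z] = if x = y ∧ y = z then 3 else if x = y ∨ y = z ∨ x = z then 2 else 1 := by
  have hsup : ∀ f : Fin 3 → ℕ, Finset.univ.sup f = max (f 0) (max (f 1) (f 2)) := fun f => by
    simp [Fin.univ_succ]
  have hcard : ∀ v, (Finset.univ.filter fun j => ![x, y, z] j = v).card =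
      (if x = v then 1 else 0) + (if y = v then 1 else 0) + (if z = v then 1 else 0) := fun v => by
    rw [Finset.card_filter, Fin.sum_univ_three]; rfl
  rw [wt, hsup, hcard, hcard, hcard]
  simp only [cons_val]
  clear hcard hsup
  by_cases hxy : x = y
  · subst hxy
    by_cases hxz : x = z
    · simp [hxz]
    · simp [hxz, Ne.symm hxz]
  · by_cases hyz : y = z
    · subst hyz; simp [hxy, Ne.symm hxy]
    · by_cases hxz : x = z
      · subst hxz; simp [hxy, hyz]
      · simp [hxy, hyz, hxz, Ne.symm hxy, Ne.symm hyz, Ne.symm hxz]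

lemma apply_oPlusCoeff (f : ℂ → ℂ) (x y z : Fin d) :
    f (oPlusCoeff ![x, y, z]) = f 2 + (f (1 - d) - f 2) * ((if x = y then 1 else 0) +
      (if y = z then 1 else 0) + (if x = z then 1 else 0)) +
      (f (1 + d ^ 2) - 3 * f (1 - d) + 2 * f 2) *
        ((if x = y then 1 else 0) * (if y = z then 1 else 0)) := by
  rw [oPlusCoeff, wt_cons₃]
  by_cases hxy : x = y
  · subst hxy
    by_cases hyz : x = z
    · subst hyz; simp; ring
    · simp [hyz, sub_eq_add_neg]
  · by_cases hyz : y = z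
    · subst hyz; simp [hxy, sub_eq_add_neg]
    · by_cases hxz : x = z
      · subst hxz; simp [hxy, hyz, sub_eq_add_neg]
      · simp [hxy, hyz, hxz]; norm_num

lemma oPlusCoeff_cons₃ (x y z : Fin d) :
    oPlusCoeff ![x, y, z] = 2 - (d + 1) * ((if x = y then 1 else 0) +
      (if y = z then 1 else 0) + (if x = z then 1 else 0)) +
      (d + 1) * (d + 2) * ((if x = y then 1 else 0) * (if y = z then 1 else 0)) := by
  rw [apply_oPlusCoeff (fun c => c)]; ring

variable {p : Fin d → ℂ}

lemma sum_indicator_mul (hp : ∑ v, p v = 1) (A B C : ℂ) (x y : Fin d) :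
    ∑ z, (A + B * ((if x = y then 1 else 0) + (if y = z then 1 else 0) +
      (if x = z then 1 else 0)) +
      C * ((if x = y then 1 else 0) * (if y = z then 1 else 0))) * p z =
    A + B * ((if x = y then 1 else 0) + p y + p x) + C * ((if x = y then 1 else 0) * p y) := by
  generalize (if x = y then (1 : ℂ) else 0) = δ
  simp only [add_mul, mul_add, Finset.sum_add_distrib, mul_assoc, ← Finset.mul_sum, hp, ite_mul,
    one_mul, zero_mul, Finset.sum_ite_eq, Finset.mem_univ, if_true, mul_one]

lemma sum_sum_indicator_mul (hp : ∑ v, p v = 1) (A B C : ℂ) (x : Fin d) :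
    ∑ y, ∑ z, (A + B * ((if x = y then 1 else 0) + (if y = z then 1 else 0) +
      (if x = z then 1 else 0)) +
      C * ((if x = y then 1 else 0) * (if y = z then 1 else 0))) * p z * p y =
    A + B * (2 * p x + ∑ v, p v ^ 2) + C * p x ^ 2 := by
  simp only [← Finset.sum_mul, sum_indicator_mul hp]
  simp only [add_mul, mul_add, Finset.sum_add_distrib, mul_assoc, ← Finset.mul_sum, hp, ite_mul,
    one_mul, zero_mul, Finset.sum_ite_eq, Finset.mem_univ, if_true, mul_one, ← pow_two]
  ring

lemma sum_apply_oPlusCoeff (hp : ∑ v, p v = 1) (f : ℂ → ℂ) :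
    ∑ a : Fin 3 → Fin d, f (oPlusCoeff a) * ∏ i, p (a i) =
      f 2 + 3 * (f (1 - d) - f 2) * ∑ v, p v ^ 2 +
        (f (1 + d ^ 2) - 3 * f (1 - d) + 2 * f 2) * ∑ v, p v ^ 3 := by
  have h : ∑ a : Fin 3 → Fin d, f (oPlusCoeff a) * ∏ i, p (a i) =
      ∑ x, (∑ y, ∑ z, f (oPlusCoeff ![x, y, z]) * p z * p y) * p x := by
    simp only [sum_fin_succ_fun, sum_fin_zero_fun, Fin.prod_univ_three, Finset.sum_mul]
    refine Finset.sum_congr rfl fun x _ => Finset.sum_congr rfl fun y _ =>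
      Finset.sum_congr rfl fun z _ => ?_
    simp; ring
  rw [h]
  simp only [apply_oPlusCoeff f, sum_sum_indicator_mul hp]
  simp only [add_mul, mul_add, Finset.sum_add_distrib, mul_assoc, ← Finset.mul_sum, hp,
    ← pow_succ, ← pow_two, mul_one]
  ring

lemma sum_tensorProduct_coeff (hp : ∑ v, p v = 1) :
    ∑ a : Fin (3 + 3) → Fin d, oPlusCoeff (fun i => a (Fin.castAdd 3 i)) *
      oPlusCoeff (fun i => a (Fin.natAdd 3 i)) * ∏ i, p (a i) =
    (2 - 3 * (d + 1) * ∑ v, p v ^ 2 + (d + 1) * (d + 2) * ∑ v, p v ^ 3) ^ 2 := by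
  rw [← (Fin.appendEquiv 3 3).sum_comp, Fintype.sum_prod_type]
  simp only [Fin.appendEquiv, Equiv.coe_fn_mk, Fin.prod_univ_add, Fin.append_left, Fin.append_right]
  have h := sum_apply_oPlusCoeff hp (fun c => c)
  trans (∑ a : Fin 3 → Fin d, oPlusCoeff a * ∏ i, p (a i)) ^ 2
  · rw [pow_two, Finset.sum_mul_sum]
    refine Finset.sum_congr rfl fun x _ => Finset.sum_congr rfl fun y _ => ?_
    ring
  · rw [h]; ring

lemma sum_o123124_coeff (hp : ∑ v, p v = 1) :
    ∑ a : Fin 4 → Fin d, oPlusCoeff ![a 0, a 1, a 2] * oPlusCoeff ![a 0, a 1, a 3] *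
      ∏ i, p (a i) =
    4 - 8 * (d + 1) * ∑ v, p v ^ 2 +
      (d + 1) ^ 2 * (2 * ∑ v, p v ^ 3 + 2 * ((∑ v, p v ^ 2) * ∑ v, p v ^ 2)) +
      ((d + 1) ^ 2 - 4 * (d + 1)) * ∑ v, p v ^ 2 +
      (4 * (d + 1) * (d + 2) + 4 * (d + 1) ^ 2 - 2 * (d + 1) ^ 2 * (d + 2)) * ∑ v, p v ^ 3 +
      ((d + 1) ^ 2 * (d + 2) ^ 2 - 4 * (d + 1) ^ 2 * (d + 2)) * ∑ v, p v ^ 4 := by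
  have h : ∑ a : Fin 4 → Fin d, oPlusCoeff ![a 0, a 1, a 2] * oPlusCoeff ![a 0, a 1, a 3] *
      ∏ i, p (a i) = ∑ x, ∑ y, (∑ z, oPlusCoeff ![x, y, z] * p z) ^ 2 * p y * p x := by
    simp only [sum_fin_succ_fun, sum_fin_zero_fun, Fin.prod_univ_four, pow_two,
      Finset.sum_mul]
    simp only [Finset.mul_sum, Finset.sum_mul]
    refine Finset.sum_congr rfl fun x _ => Finset.sum_congr rfl fun y _ =>
      Finset.sum_congr rfl fun z _ => Finset.sum_congr rfl fun w _ => ?_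
    simp; ring
  have hin : ∀ x y, (∑ z, oPlusCoeff ![x, y, z] * p z) ^ 2 * p y * p x =
      4 * (p y * p x) - 4 * (d + 1) * (p y ^ 2 * p x + p y * p x ^ 2) +
      (d + 1) ^ 2 * (p y ^ 3 * p x + 2 * (p y ^ 2 * p x ^ 2) + p y * p x ^ 3) +
      (if x = y then ((d + 1) ^ 2 - 4 * (d + 1)) * p y ^ 2 +
      (4 * (d + 1) * (d + 2) + 4 * (d + 1) ^ 2 - 2 * (d + 1) ^ 2 * (d + 2)) * p y ^ 3 +
      ((d + 1) ^ 2 * (d + 2) ^ 2 - 4 * (d + 1) ^ 2 * (d + 2)) * p y ^ 4 else 0) := by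
    intro x y
    simp only [oPlusCoeff_cons₃, sub_eq_add_neg, ← neg_mul, sum_indicator_mul hp]
    split_ifs with hxy
    · subst hxy; ring
    · ring
  rw [h]
  simp only [hin, Finset.sum_add_distrib, Finset.sum_sub_distrib, ← Finset.mul_sum,
    ← Finset.sum_mul, hp, Finset.sum_ite_eq, Finset.mem_univ, if_true]
  ring

lemma sum_o123145_coeff (hp : ∑ v, p v = 1) :
    ∑ a : Fin 5 → Fin d, oPlusCoeff ![a 0, a 1, a 2] * oPlusCoeff ![a 0, a 3, a 4] *
      ∏ i, p (a i) =
    4 - 12 * (d + 1) * ∑ v, p v ^ 2 + (4 * (d + 1) ^ 2 + 4 * (d + 1) * (d + 2)) * ∑ v, p v ^ 3 -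
      4 * (d + 1) ^ 2 * (d + 2) * ∑ v, p v ^ 4 + (d + 1) ^ 2 * (d + 2) ^ 2 * ∑ v, p v ^ 5 +
      5 * (d + 1) ^ 2 * ((∑ v, p v ^ 2) * ∑ v, p v ^ 2) -
      2 * (d + 1) ^ 2 * (d + 2) * ((∑ v, p v ^ 2) * ∑ v, p v ^ 3) := by
  have h : ∑ a : Fin 5 → Fin d, oPlusCoeff ![a 0, a 1, a 2] * oPlusCoeff ![a 0, a 3, a 4] *
      ∏ i, p (a i) = ∑ x, (∑ y, ∑ z, oPlusCoeff ![x, y, z] * p z * p y) *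
        (∑ y, ∑ z, oPlusCoeff ![x, y, z] * p z * p y) * p x := by
    simp only [sum_fin_succ_fun, sum_fin_zero_fun, Fin.prod_univ_five]
    simp only [Finset.sum_mul]
    simp only [Finset.mul_sum, Finset.sum_mul]
    refine Finset.sum_congr rfl fun x _ => Finset.sum_congr rfl fun y _ =>
      Finset.sum_congr rfl fun z _ => Finset.sum_congr rfl fun u _ =>
      Finset.sum_congr rfl fun w _ => ?_
    simp; ring
  rw [h]
  simp only [oPlusCoeff_cons₃, sub_eq_add_neg, ← neg_mul, sum_sum_indicator_mul hp]
  set s := ∑ v, p v ^ 2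
  have hx : ∀ q : ℂ, (2 + -(d + 1) * (2 * q + s) + (d + 1) * (d + 2) * q ^ 2) *
      (2 + -(d + 1) * (2 * q + s) + (d + 1) * (d + 2) * q ^ 2) * q =
      (2 - (d + 1) * s) ^ 2 * q - 4 * (d + 1) * (2 - (d + 1) * s) * q ^ 2 +
      (4 * (d + 1) ^ 2 + 2 * (2 - (d + 1) * s) * (d + 1) * (d + 2)) * q ^ 3 -
      4 * (d + 1) ^ 2 * (d + 2) * q ^ 4 + (d + 1) ^ 2 * (d + 2) ^ 2 * q ^ 5 := by
    intro q; ring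
  simp only [hx, Finset.sum_add_distrib, Finset.sum_sub_distrib, ← Finset.mul_sum, hp]
  ring

variable {μ : Measure (unitaryGroup (Fin d) ℂ)}

lemma pos_of_unit_vector (hψ : star ψ ⬝ᵥ ψ = 1) : 0 < d := by
  rcases Nat.eq_zero_or_pos d with rfl | h
  · simp [dotProduct] at hψ
  · exact h

lemma cast_add_ne_zero (hd : 0 < d) (k : ℕ) : (d : ℂ) + k ≠ 0 := by
  exact_mod_cast (by omega : d + k ≠ 0)

lemma tensorProduct_oPlus :
    tensorProduct (oPlus d) (oPlus d) = diagonal fun a : Fin (3 + 3) → Fin d =>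
    oPlusCoeff (fun i => a (Fin.castAdd 3 i)) * oPlusCoeff (fun i => a (Fin.natAdd 3 i)) := by
  ext a b
  simp only [tensorProduct, oPlus, of_apply, diagonal_apply]
  by_cases hab : a = b
  · subst hab; simp
  · have : ¬ ((fun i => a (Fin.castAdd 3 i)) = (fun i => b (Fin.castAdd 3 i)) ∧
        (fun i => a (Fin.natAdd 3 i)) = (fun i => b (Fin.natAdd 3 i))) := fun h =>
      hab (funext (Fin.addCases (congrFun h.1) (congrFun h.2)))
    rw [if_neg hab]
    by_cases h : (fun i => a (Fin.castAdd 3 i)) = (fun i => b (Fin.castAdd 3 i))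
    · rw [if_neg (fun h' => this ⟨h, h'⟩), mul_zero]
    · rw [if_neg h, zero_mul]

lemma IsUnitaryDesign.integral_powerSum_combination (hμ : IsUnitaryDesign 6 μ)
    (hψ : star ψ ⬝ᵥ ψ = 1) (c₀ c₂ c₃ c₄ c₅ c₂₂ c₂₃ c₃₃ : ℂ) :
    ∫ U, (c₀ + c₂ * powerSum ψ 2 U + c₃ * powerSum ψ 3 U + c₄ * powerSum ψ 4 U +
      c₅ * powerSum ψ 5 U + c₂₂ * (powerSum ψ 2 U * powerSum ψ 2 U) +
      c₂₃ * (powerSum ψ 2 U * powerSum ψ 3 U) + c₃₃ * (powerSum ψ 3 U * powerSum ψ 3 U)) ∂μ =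
    c₀ + c₂ * (2 / (d + 1)) + c₃ * (6 / ((d + 1) * (d + 2))) +
      c₄ * (24 / ((d + 1) * (d + 2) * (d + 3))) +
      c₅ * (120 / ((d + 1) * (d + 2) * (d + 3) * (d + 4))) +
      c₂₂ * (4 * (d + 5) / ((d + 1) * (d + 2) * (d + 3))) +
      c₂₃ * (12 * (d + 9) / ((d + 1) * (d + 2) * (d + 3) * (d + 4))) +
      c₃₃ * (36 * (d + 19) / ((d + 1) * (d + 2) * (d + 3) * (d + 4) * (d + 5))) := by
  have := hμ.1
  have hd : 0 < d := pos_of_unit_vector hψ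
  rw [integral_add, integral_add, integral_add, integral_add, integral_add, integral_add,
    integral_add]
  · simp only [integral_const_mul, integral_const, hμ.integral_powerSum hψ (show 2 ≤ 6 by norm_num),
      hμ.integral_powerSum hψ (show 3 ≤ 6 by norm_num),
      hμ.integral_powerSum hψ (show 4 ≤ 6 by norm_num),
      hμ.integral_powerSum hψ (show 5 ≤ 6 by norm_num),
      hμ.integral_powerSum_mul hψ (show 2 + 2 ≤ 6 by norm_num),
      hμ.integral_powerSum_mul hψ (show 2 + 3 ≤ 6 by norm_num),
      hμ.integral_powerSum_mul hψ (show 3 + 3 ≤ 6 by norm_num)]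
    have h0 := cast_add_ne_zero hd 0
    have h1 := cast_add_ne_zero hd 1
    have h2 := cast_add_ne_zero hd 2
    have h3 := cast_add_ne_zero hd 3
    have h4 := cast_add_ne_zero hd 4
    have h5 := cast_add_ne_zero hd 5
    norm_num [Finset.prod_range_succ, Nat.factorial, Nat.choose] at h0 h1 h2 h3 h4 h5 ⊢
    field_simp
    ring
  all_goals exact integrable_of_continuous (by fun_prop)

lemma Gamma6_eq (hμ : IsUnitaryDesign 6 μ) (hψ : star ψ ⬝ᵥ ψ = 1) :
    Gamma6 μ (vecMulVec ψ (star ψ)) =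
      4 * (((d : ℂ) ^ 4 + 59 * d ^ 3 + 107 * d ^ 2 + 109 * d + 84) /
        ((d : ℂ) ^ 4 + 14 * d ^ 3 + 71 * d ^ 2 + 154 * d + 120)) := by
  have := hμ.1
  have hd : 0 < d := pos_of_unit_vector hψ
  have h := hμ.integral_powerSum_combination hψ 4 (-12 * (d + 1)) (4 * (d + 1) * (d + 2)) 0 0
    (9 * (d + 1) ^ 2) (-6 * (d + 1) ^ 2 * (d + 2)) ((d + 1) ^ 2 * (d + 2) ^ 2)
  have hpt := fun U : unitaryGroup (Fin d) ℂ => sum_tensorProduct_coeff (sum_prob hψ U)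
  simp only [← powerSum.eq_def] at hpt
  rw [Gamma6, tensorProduct_oPlus, varianceTerm_diagonal]
  refine (integral_congr_ae (.of_forall fun U => ?_)).trans (h.trans ?_)
  · refine (hpt U).trans ?_
    ring
  have hden : (d : ℂ) ^ 4 + 14 * d ^ 3 + 71 * d ^ 2 + 154 * d + 120 = (d + 2) * (d + 3) * (d + 4) * (d + 5) := by ring
  rw [hden]
  have h1 := cast_add_ne_zero hd 1
  have h2 := cast_add_ne_zero hd 2
  have h3 := cast_add_ne_zero hd 3
  have h4 := cast_add_ne_zero hd 4
  have h5 := cast_add_ne_zero hd 5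
  push_cast at h1 h2 h3 h4 h5
  field_simp
  ring

lemma Gamma5_eq (hμ : IsUnitaryDesign 6 μ) (hψ : star ψ ⬝ᵥ ψ = 1) :
    Gamma5 μ (vecMulVec ψ (star ψ)) =
      (48 * (d : ℂ) ^ 3 + 68 * d ^ 2 + 60 * d + 64) /
        ((d : ℂ) ^ 3 + 9 * d ^ 2 + 26 * d + 24) := by
  have := hμ.1
  have hd : 0 < d := pos_of_unit_vector hψ
  have h := hμ.integral_powerSum_combination hψ 4 (-12 * (d + 1))
    (4 * (d + 1) ^ 2 + 4 * (d + 1) * (d + 2)) (-4 * (d + 1) ^ 2 * (d + 2))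
    ((d + 1) ^ 2 * (d + 2) ^ 2) (5 * (d + 1) ^ 2) (-2 * (d + 1) ^ 2 * (d + 2)) 0
  have hpt := fun U : unitaryGroup (Fin d) ℂ => sum_o123145_coeff (sum_prob hψ U)
  simp only [← powerSum.eq_def] at hpt
  rw [Gamma5, o123145, varianceTerm_diagonal]
  refine (integral_congr_ae (.of_forall fun U => ?_)).trans (h.trans ?_)
  · refine (hpt U).trans ?_
    ring
  have hden : (d : ℂ) ^ 3 + 9 * d ^ 2 + 26 * d + 24 = (d + 2) * (d + 3) * (d + 4) := by ring
  rw [hden]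
  have h1 := cast_add_ne_zero hd 1
  have h2 := cast_add_ne_zero hd 2
  have h3 := cast_add_ne_zero hd 3
  have h4 := cast_add_ne_zero hd 4
  push_cast at h1 h2 h3 h4
  field_simp
  ring

lemma Gamma4_eq (hμ : IsUnitaryDesign 6 μ) (hψ : star ψ ⬝ᵥ ψ = 1) :
    Gamma4 μ (vecMulVec ψ (star ψ)) =
      2 * ((7 * (d : ℂ) ^ 3 + 6 * d ^ 2 + 3 * d + 8) / ((d : ℂ) ^ 2 + 5 * d + 6)) := by
  have := hμ.1
  have hd : 0 < d := pos_of_unit_vector hψ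
  have h := hμ.integral_powerSum_combination hψ 4 (-8 * (d + 1) + (d + 1) ^ 2 - 4 * (d + 1))
    (2 * (d + 1) ^ 2 + 4 * (d + 1) * (d + 2) + 4 * (d + 1) ^ 2 - 2 * (d + 1) ^ 2 * (d + 2))
    ((d + 1) ^ 2 * (d + 2) ^ 2 - 4 * (d + 1) ^ 2 * (d + 2)) 0 (2 * (d + 1) ^ 2) 0 0
  have hpt := fun U : unitaryGroup (Fin d) ℂ => sum_o123124_coeff (sum_prob hψ U)
  simp only [← powerSum.eq_def] at hpt
  rw [Gamma4, o123124, varianceTerm_diagonal]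
  refine (integral_congr_ae (.of_forall fun U => ?_)).trans (h.trans ?_)
  · refine (hpt U).trans ?_
    ring
  have hden : (d : ℂ) ^ 2 + 5 * d + 6 = (d + 2) * (d + 3) := by ring
  rw [hden]
  have h1 := cast_add_ne_zero hd 1
  have h2 := cast_add_ne_zero hd 2
  have h3 := cast_add_ne_zero hd 3
  push_cast at h1 h2 h3
  field_simp
  ring

lemma Gamma3_eq (hμ : IsUnitaryDesign 6 μ) (hψ : star ψ ⬝ᵥ ψ = 1) :
    Gamma3 μ (vecMulVec ψ (star ψ)) =
      (6 * (d : ℂ) ^ 3 - 2 * d + 8) / (d + 2) := by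
  have := hμ.1
  have hd : 0 < d := pos_of_unit_vector hψ
  have h := hμ.integral_powerSum_combination hψ 4 (3 * ((1 - d) ^ 2 - 4))
    ((1 + d ^ 2) ^ 2 - 3 * (1 - d) ^ 2 + 8) 0 0 0 0 0
  have hpt := fun U : unitaryGroup (Fin d) ℂ => sum_apply_oPlusCoeff (sum_prob hψ U) (fun c => c ^ 2)
  simp only [← powerSum.eq_def] at hpt
  rw [Gamma3, oPlus, diagonal_pow, varianceTerm_diagonal]
  refine (integral_congr_ae (.of_forall fun U => ?_)).trans (h.trans ?_)
  · refine (hpt U).trans ?_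
    ring
  have h1 := cast_add_ne_zero hd 1
  have h2 := cast_add_ne_zero hd 2
  push_cast at h1 h2
  field_simp
  ring

end UnitaryTwirl

theorem mainTheorem8 (d : ℕ) (μ : MeasureTheory.Measure (Matrix.unitaryGroup (Fin d) ℂ))
    (hμ : UnitaryTwirl.IsUnitaryDesign 6 μ)
    (ρ : Matrix (Fin d) (Fin d) ℂ) (hρ : UnitaryTwirl.IsPureState ρ) :
    (UnitaryTwirl.Gamma6 μ ρ =
        ((4 * (((d : ℝ) ^ 4 + 59 * (d : ℝ) ^ 3 + 107 * (d : ℝ) ^ 2 + 109 * (d : ℝ) + 84) /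
          ((d : ℝ) ^ 4 + 14 * (d : ℝ) ^ 3 + 71 * (d : ℝ) ^ 2 + 154 * (d : ℝ) + 120)) : ℝ) : ℂ) ∧
      4 * (((d : ℝ) ^ 4 + 59 * (d : ℝ) ^ 3 + 107 * (d : ℝ) ^ 2 + 109 * (d : ℝ) + 84) /
          ((d : ℝ) ^ 4 + 14 * (d : ℝ) ^ 3 + 71 * (d : ℝ) ^ 2 + 154 * (d : ℝ) + 120)) < 10) ∧
    (UnitaryTwirl.Gamma5 μ ρ =
        (((48 * (d : ℝ) ^ 3 + 68 * (d : ℝ) ^ 2 + 60 * (d : ℝ) + 64) /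
          ((d : ℝ) ^ 3 + 9 * (d : ℝ) ^ 2 + 26 * (d : ℝ) + 24) : ℝ) : ℂ) ∧
      (48 * (d : ℝ) ^ 3 + 68 * (d : ℝ) ^ 2 + 60 * (d : ℝ) + 64) /
          ((d : ℝ) ^ 3 + 9 * (d : ℝ) ^ 2 + 26 * (d : ℝ) + 24) < 48) ∧
    (UnitaryTwirl.Gamma4 μ ρ =
        ((2 * ((7 * (d : ℝ) ^ 3 + 6 * (d : ℝ) ^ 2 + 3 * (d : ℝ) + 8) /
          ((d : ℝ) ^ 2 + 5 * (d : ℝ) + 6)) : ℝ) : ℂ) ∧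
      2 * ((7 * (d : ℝ) ^ 3 + 6 * (d : ℝ) ^ 2 + 3 * (d : ℝ) + 8) /
          ((d : ℝ) ^ 2 + 5 * (d : ℝ) + 6)) < 14 * (d : ℝ)) ∧
    (UnitaryTwirl.Gamma3 μ ρ =
        (((6 * (d : ℝ) ^ 3 - 2 * (d : ℝ) + 8) / ((d : ℝ) + 2) : ℝ) : ℂ) ∧
      (6 * (d : ℝ) ^ 3 - 2 * (d : ℝ) + 8) / ((d : ℝ) + 2) < 6 * (d : ℝ) ^ 2) := by
  obtain ⟨ψ, hψ, rfl⟩ := hρ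
  have hd : (1 : ℝ) ≤ d := by exact_mod_cast UnitaryTwirl.pos_of_unit_vector hψ
  refine ⟨⟨?_, ?_⟩, ⟨?_, ?_⟩, ⟨?_, ?_⟩, ⟨?_, ?_⟩⟩
  · rw [UnitaryTwirl.Gamma6_eq hμ hψ]; push_cast; rfl
  · rw [← mul_div_assoc, div_lt_iff₀ (by positivity)]
    nlinarith [sq_nonneg ((d : ℝ) ^ 2 - 8 * d - 4), sq_nonneg ((d : ℝ) - 8)]
  · rw [UnitaryTwirl.Gamma5_eq hμ hψ]; push_cast; rfl
  · rw [div_lt_iff₀ (by positivity)]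
    nlinarith
  · rw [UnitaryTwirl.Gamma4_eq hμ hψ]; push_cast; rfl
  · rw [← mul_div_assoc, div_lt_iff₀ (by positivity)]
    nlinarith
  · rw [UnitaryTwirl.Gamma3_eq hμ hψ]; push_cast; rfl
  · rw [div_lt_iff₀ (by positivity)]
    nlinarith
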